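/- A seller offers $k$ items to a single buyer whose valuation is a random vector $x\in\mathbb{R}_+^k$ with known distribution $\mathcal F$. A mechanism is a pair $(q,s)$ of functions of $x\in\mathbb R_+^k$: the allocation probabilities $q(x)\in[0,1]^k$ and the (expected) payment $s(x)\in\mathbb{R}$ ($s$ measurable). It is incentive compatible (IC) if $x\cdot q(x)-s(x)\ge x\cdot q(y)-s(y)$ for all $x,y\in\mathbb{R}_+^k$, and individually rational (IR) if $x\cdot q(x)-s(x)\ge 0$ for all $x\in\mathbb{R}_+^k$; its revenue is $\mathbb{E}_{x\sim\mathcal F}[s(x)]$. For a probability distribution $F$ on $\mathbb{R}_+$, $\mathrm{Rev}(F)\in[0,\infty]$ is the supremum of the revenue over all IC and IR mechanisms for one item with value distributed according to $F$. For a distribution $\mathcal F$ on $\mathbb{R}_+^k$, $\mathrm{SRev}(\mathcal F)$ is the supremum of the revenue when each item $i$ is sold separately by some IC and IR one-item mechanism (applied to $x_i$), and $\mathrm{BRev}(\mathcal F)$ is the supremum of the revenue when all items are sold together as one bundle by some IC and IR one-item mechanism (applied to $x_1+\cdots+x_k$). Values of these quantities may be $+\infty$. (i) Let $w$ be the unique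 real solution of $we^w=1/e$, so that $1+w=1.278\ldots$. For all probability distributions $F_1,F_2$ on $\mathbb{R}_+$, $$\mathrm{BRev}(F_1\times F_2)\le (1+w)\bigl(\mathrm{Rev}(F_1)+\mathrm{Rev}(F_2)\bigr)=(1+w)\,\mathrm{SRev}(F_1\times F_2).$$ (ii) There is a constant $c>0$ such that for every integer $k\ge 2$ and all probability distributions $F_1,\dots,F_k$ on $\mathbb{R}_+$, $$\mathrm{BRev}(F_1\times\cdots\times F_k)\le c\log k\cdot\sum_{i=1}^k\mathrm{Rev}(F_i)=c\log k\cdot\mathrm{SRev}(F_1\times\cdots\times F_k),$$ where $\log$ is the natural logarithm. -/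

import Mathlib

open MeasureTheory
open scoped NNReal ENNReal

/-- A (direct) mechanism for selling `k` items to one additive, risk-neutral buyer whose valuation
is a vector `x` of `k` nonnegative reals: `q x i` is the probability that item `i` is allocated to
the buyer, and `s x` is the expected payment to the seller (of either sign). -/
structure Mechanism (k : ℕ) where
  q : (Fin k → ℝ≥0) → Fin k → ℝ
  s : (Fin k → ℝ≥0) → ℝ
  q_mem : ∀ x i, q x i ∈ Set.Icc (0 : ℝ) 1
  measurable_s : Measurable s

namespace Mechanism

/-- The utility of a buyer with valuation `x` who reports `y`. -/
def utility {k : ℕ} (m : Mechanism k) (x y : Fin k → ℝ≥0) : ℝ :=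
  ∑ i, (x i : ℝ) * m.q y i - m.s y

/-- Incentive compatibility: truthful reporting is optimal. -/
def IsIC {k : ℕ} (m : Mechanism k) : Prop := ∀ x y, m.utility x y ≤ m.utility x x

/-- (Ex-post) individual rationality: the truthful utility is nonnegative. -/
def IsIR {k : ℕ} (m : Mechanism k) : Prop := ∀ x, 0 ≤ m.utility x x

/-- The expected payment of the buyer when the valuation has law `μ`, with values in `[0, ∞]`:
the integral of the positive part of `s` minus that of the negative part. For an incentive
compatible mechanism `s ≥ s 0`, so for a probability measure `μ` the second integral is finite; a
negative expectation is truncated to `0`, which does not affect the suprema below, since the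
mechanism that never sells and never charges has revenue `0`. -/
noncomputable def revenue {k : ℕ} (m : Mechanism k) (μ : Measure (Fin k → ℝ≥0)) : ℝ≥0∞ :=
  (∫⁻ x, ENNReal.ofReal (m.s x) ∂μ) - ∫⁻ x, ENNReal.ofReal (-m.s x) ∂μ

/-- Selling the `k` items separately: item `i` is sold by the one-item mechanism `m i`. -/
def separate {k : ℕ} (m : Fin k → Mechanism 1) : Mechanism k where
  q x i := (m i).q (fun _ => x i) 0
  s x := ∑ i, (m i).s (fun _ => x i)
  q_mem _ i := (m i).q_mem _ 0
  measurable_s := Finset.measurable_sum _ fun i _ =>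
    (m i).measurable_s.comp (measurable_pi_lambda _ fun _ => measurable_pi_apply i)

/-- Selling the `k` items as one bundle, whose value to the buyer is `∑ i, x i`, by the one-item
mechanism `m`. -/
def bundle (k : ℕ) (m : Mechanism 1) : Mechanism k where
  q x _ := m.q (fun _ => ∑ j, x j) 0
  s x := m.s (fun _ => ∑ j, x j)
  q_mem _ _ := m.q_mem _ 0
  measurable_s := m.measurable_s.comp (measurable_pi_lambda _ fun _ =>
    Finset.measurable_sum _ fun j _ => measurable_pi_apply j)

end Mechanism

/-- The optimal revenue from `k` items with joint law `μ` of the valuation: the supremum over all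
incentive compatible and individually rational mechanisms. -/
noncomputable def Rev {k : ℕ} (μ : Measure (Fin k → ℝ≥0)) : ℝ≥0∞ :=
  ⨆ (m : Mechanism k) (_ : m.IsIC ∧ m.IsIR), m.revenue μ

/-- The optimal revenue from one item whose value has law `F`. -/
noncomputable def Rev₁ (F : Measure ℝ≥0) : ℝ≥0∞ :=
  Rev (F.map fun v (_ : Fin 1) => v)

/-- The maximal revenue obtainable by selling each item separately. -/
noncomputable def SRev {k : ℕ} (μ : Measure (Fin k → ℝ≥0)) : ℝ≥0∞ :=
  ⨆ (m : Fin k → Mechanism 1) (_ : ∀ i, (m i).IsIC ∧ (m i).IsIR),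
    (Mechanism.separate m).revenue μ

/-- The maximal revenue obtainable by bundling all items together. -/
noncomputable def BRev {k : ℕ} (μ : Measure (Fin k → ℝ≥0)) : ℝ≥0∞ :=
  ⨆ (m : Mechanism 1) (_ : m.IsIC ∧ m.IsIR), (Mechanism.bundle k m).revenue μ

/-! For one item, incentive compatibility traps each payment increment between the two endpoint
values times the allocation increment. So allocation and payment are monotone, and the payment is
essentially a mixture of posted prices of total weight at most 1. Hence `Rev₁` is `sup p * P(X ≥
p)`, `SRev` of a product is the sum of these, and `BRev` is at most the best posted price on the
sum. A bound `a` on `Rev₁` enters only through the tail `P(X ≥ t) ≤ a / t`.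

Two items (`prod_tail_le`): for a price `p > a + b`, conditioning on the first value and integrating
the two tails bounds the revenue by `a + b + (ab/p) (log((p-a)/a) + log((p-b)/b))`. The inequality
`log z ≤ w(1 + z)`, which is where `w` enters, turns this into `(1 + w)(a + b)`. For `p ≤ a + b` the
price itself is a sufficient bound.

Many items (`pi_tail_le`): put `M = p / 2` and `R = ∑ a i`. Either some value reaches `M`, with
probability at most `R / M`, or the values truncated at `M` sum to at least `2M`. Their total mean
is at most `M` once `M ≥ 6 R log k`, and their variances total at most `2RM`, so Chebyshev gives `2R
/ M`. Such prices therefore earn at most `6R`, and smaller ones at most `12 R log k`. -/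

/-- The optimal revenue of a posted price for one item whose value has law `F`. -/
noncomputable def postedRev (F : Measure ℝ≥0) : ℝ≥0∞ :=
  ⨆ p : ℝ≥0, (p : ℝ≥0∞) * F (Set.Ici p)

theorem le_postedRev (F : Measure ℝ≥0) (p : ℝ≥0) : (p : ℝ≥0∞) * F (Set.Ici p) ≤ postedRev F :=
  le_iSup (fun p : ℝ≥0 => (p : ℝ≥0∞) * F (Set.Ici p)) p

/-! ### One item: posted prices are optimal -/

namespace Mechanism

theorem utility_one (m : Mechanism 1) (x y : ℝ≥0) :
    m.utility (fun _ => x) (fun _ => y) = x * m.q (fun _ => y) 0 - m.s (fun _ => y) := by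
  simp [utility]

theorem IsIC.payment_sub_le {m : Mechanism 1} (h : m.IsIC) (x y : ℝ≥0) :
    m.s (fun _ => y) - m.s (fun _ => x) ≤ y * (m.q (fun _ => y) 0 - m.q (fun _ => x) 0) := by
  have := h (fun _ => y) (fun _ => x)
  rw [utility_one, utility_one] at this
  linarith

theorem IsIC.le_payment_sub {m : Mechanism 1} (h : m.IsIC) (x y : ℝ≥0) :
    x * (m.q (fun _ => y) 0 - m.q (fun _ => x) 0) ≤ m.s (fun _ => y) - m.s (fun _ => x) := by
  have := h (fun _ => x) (fun _ => y)
  rw [utility_one, utility_one] at this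
  linarith

theorem IsIC.monotone_q {m : Mechanism 1} (h : m.IsIC) :
    Monotone fun x : ℝ≥0 => m.q (fun _ => x) 0 := by
  intro x y hxy
  rcases hxy.eq_or_lt with rfl | hlt
  · exact le_rfl
  have h1 := h.payment_sub_le x y
  have h2 := h.le_payment_sub x y
  have h3 : (x : ℝ) < y := hlt
  by_contra! h4
  nlinarith

theorem IsIC.monotone_s {m : Mechanism 1} (h : m.IsIC) :
    Monotone fun x : ℝ≥0 => m.s (fun _ => x) := by
  intro x y hxy
  have h1 := h.le_payment_sub x y
  have h2 := h.monotone_q hxy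
  have h3 : (0 : ℝ) ≤ x * (m.q (fun _ => y) 0 - m.q (fun _ => x) 0) :=
    mul_nonneg x.2 (sub_nonneg.2 h2)
  linarith

theorem IsIR.payment_zero_nonpos {m : Mechanism 1} (h : m.IsIR) :
    m.s (fun _ => (0 : ℝ≥0)) ≤ 0 := by
  have := h (fun _ => 0)
  rw [utility_one] at this
  simpa using this

/-- The payment is at most the discretised Stieltjes integral of the price against the
allocation. -/
theorem payment_grid_le {m : Mechanism 1} (hic : m.IsIC) (hir : m.IsIR) (ε : ℝ≥0) (n : ℕ) :
    m.s (fun _ => n * ε) ≤ ∑ i ∈ Finset.range n, ((i + 1) * ε : ℝ) *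
      (m.q (fun _ => ((i + 1 : ℕ) : ℝ≥0) * ε) 0 - m.q (fun _ => (i : ℝ≥0) * ε) 0) := by
  induction n with
  | zero => simpa using hir.payment_zero_nonpos
  | succ n ih =>
    rw [Finset.sum_range_succ]
    have := hic.payment_sub_le ((n : ℝ≥0) * ε) (((n + 1 : ℕ) : ℝ≥0) * ε)
    have h2 : ((((n + 1 : ℕ) : ℝ≥0) * ε : ℝ≥0) : ℝ) = (n + 1) * ε := by push_cast; ring
    rw [h2] at this
    linarith

/-- Rounding `x` up to the grid can only raise the payment. Each grid increment becomes an indicator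
of a half-line, so that integration turns the bound into prices times tails. -/
theorem ofReal_payment_le {m : Mechanism 1} (hic : m.IsIC) (hir : m.IsIR) {ε : ℝ≥0} (hε : 0 < ε)
    (x : ℝ≥0) :
    ENNReal.ofReal (m.s (fun _ => x)) ≤ ∑' i : ℕ, (Set.Ici ((i : ℝ≥0) * ε)).indicator
      (fun _ => (((i + 1 : ℕ) : ℝ≥0) * ε : ℝ≥0) * ENNReal.ofReal
        (m.q (fun _ => ((i + 1 : ℕ) : ℝ≥0) * ε) 0 - m.q (fun _ => (i : ℝ≥0) * ε) 0)) x := by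
  set n := ⌊x / ε⌋₊
  have hn : (n : ℝ≥0) * ε ≤ x := by
    rw [← le_div_iff₀ hε]; exact Nat.floor_le (zero_le)
  have hn' : x ≤ ((n + 1 : ℕ) : ℝ≥0) * ε := by
    rw [← div_le_iff₀ hε]; push_cast; exact (Nat.lt_floor_add_one _).le
  have hnn : ∀ i : ℕ, 0 ≤ m.q (fun _ => ((i + 1 : ℕ) : ℝ≥0) * ε) 0 -
      m.q (fun _ => (i : ℝ≥0) * ε) 0 := fun i => by
    refine sub_nonneg.2 (hic.monotone_q ?_)
    gcongr
    exact i.le_succ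
  refine le_trans ?_ (ENNReal.sum_le_tsum (Finset.range (n + 1)))
  refine (ENNReal.ofReal_le_ofReal ((hic.monotone_s hn').trans
    (payment_grid_le hic hir ε (n + 1)))).trans ?_
  rw [ENNReal.ofReal_sum_of_nonneg
    fun i _ => mul_nonneg (by positivity) (hnn i)]
  refine Finset.sum_le_sum fun i hi => ?_
  have hi' : (i : ℝ≥0) * ε ≤ x := by
    refine le_trans ?_ hn
    gcongr
    exact Nat.lt_succ_iff.1 (Finset.mem_range.1 hi)
  rw [Set.indicator_of_mem (by exact hi'), ENNReal.ofReal_mul (by positivity),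
    ← ENNReal.ofReal_coe_nnreal]
  push_cast
  exact le_rfl

/-- No incentive compatible and individually rational mechanism for one item extracts more than
the best posted price. -/
theorem lintegral_payment_le_postedRev {m : Mechanism 1} (hic : m.IsIC) (hir : m.IsIR)
    (F : Measure ℝ≥0) [IsProbabilityMeasure F] :
    ∫⁻ x, ENNReal.ofReal (m.s (fun _ => x)) ∂F ≤ postedRev F := by
  refine ENNReal.le_of_forall_pos_le_add fun ε hε _ => ?_
  refine (lintegral_mono (ofReal_payment_le hic hir hε)).trans ?_
  rw [lintegral_tsum fun i => (measurable_const.indicator measurableSet_Ici).aemeasurable]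
  -- The price `(i + 1) * ε` is paired with the tail at `i * ε`; this mismatch costs at most `ε`.
  -- The weights telescope to a difference of two probabilities, hence sum to at most 1.
  have hstep : ∀ i : ℕ, ∫⁻ x, (Set.Ici ((i : ℝ≥0) * ε)).indicator
      (fun _ => ((((i + 1 : ℕ) : ℝ≥0) * ε : ℝ≥0) : ℝ≥0∞) * ENNReal.ofReal
        (m.q (fun _ => ((i + 1 : ℕ) : ℝ≥0) * ε) 0 - m.q (fun _ => (i : ℝ≥0) * ε) 0)) x ∂F ≤
      ENNReal.ofReal (m.q (fun _ => ((i + 1 : ℕ) : ℝ≥0) * ε) 0 - m.q (fun _ => (i : ℝ≥0) * ε) 0) *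
        (postedRev F + ε) := fun i => by
    rw [lintegral_indicator_const measurableSet_Ici, mul_comm (ENNReal.ofNNReal _), mul_assoc]
    gcongr
    have : (((i + 1 : ℕ) : ℝ≥0) * ε : ℝ≥0) = (i : ℝ≥0) * ε + ε := by push_cast; ring
    rw [this, ENNReal.coe_add, add_mul]
    exact add_le_add (le_postedRev F _) (mul_le_of_le_one_right (zero_le) prob_le_one)
  refine (ENNReal.tsum_le_tsum hstep).trans ?_
  rw [ENNReal.tsum_mul_right]
  refine mul_le_of_le_one_left (zero_le) (ENNReal.tsum_le_of_sum_range_le fun n => ?_)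
  rw [← ENNReal.ofReal_sum_of_nonneg, Finset.sum_range_sub
    (fun i : ℕ => m.q (fun _ => (i : ℝ≥0) * ε) 0), ENNReal.ofReal_le_one]
  · linarith [(m.q_mem (fun _ => (n : ℝ≥0) * ε) 0).2,
      (m.q_mem (fun _ => ((0 : ℕ) : ℝ≥0) * ε) 0).1]
  · intro i _
    refine sub_nonneg.2 (hic.monotone_q ?_)
    gcongr
    exact i.le_succ

/-- Selling one item at the posted price `p`. -/
noncomputable def posted (p : ℝ≥0) : Mechanism 1 where
  q x _ := if p ≤ x 0 then 1 else 0
  s x := if p ≤ x 0 then p else 0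
  q_mem x _ := by split_ifs <;> simp
  measurable_s := Measurable.ite (measurableSet_le measurable_const (measurable_pi_apply 0))
    measurable_const measurable_const

theorem isIC_posted (p : ℝ≥0) : (posted p).IsIC := by
  intro x y
  simp only [utility, posted, Finset.univ_unique, Fin.default_eq_zero, Finset.sum_singleton]
  split_ifs with h1 h2 h2
  · exact le_rfl
  · have : (x 0 : ℝ) < p := not_le.1 h2
    simp only [mul_one, mul_zero]
    linarith
  · have : (p : ℝ) ≤ x 0 := h2
    simp only [mul_one, mul_zero]
    linarith
  · exact le_rfl

theorem isIR_posted (p : ℝ≥0) : (posted p).IsIR := by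
  intro x
  simp only [utility, posted, Finset.univ_unique, Fin.default_eq_zero, Finset.sum_singleton]
  split_ifs with h
  · have : (p : ℝ) ≤ x 0 := h
    linarith
  · simp

theorem lintegral_posted (p : ℝ≥0) (F : Measure ℝ≥0) :
    ∫⁻ x, ENNReal.ofReal ((posted p).s fun _ => x) ∂F = p * F (Set.Ici p) := by
  rw [← lintegral_indicator_const measurableSet_Ici]
  refine lintegral_congr fun x => ?_
  by_cases h : p ≤ x
  · simp [posted, h]
  · simp [posted, h]

theorem posted_nonneg (p : ℝ≥0) (x : Fin 1 → ℝ≥0) : 0 ≤ (posted p).s x := by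
  simp only [posted]; split_ifs <;> simp

theorem revenue_eq_of_nonneg {k : ℕ} (m : Mechanism k) (h : ∀ x, 0 ≤ m.s x)
    (μ : Measure (Fin k → ℝ≥0)) : m.revenue μ = ∫⁻ x, ENNReal.ofReal (m.s x) ∂μ := by
  simp [revenue, ENNReal.ofReal_of_nonpos (neg_nonpos.2 (h _))]

end Mechanism

open Mechanism

/-! ### The three revenues in terms of posted prices -/

theorem Rev₁_eq_postedRev (F : Measure ℝ≥0) [IsProbabilityMeasure F] : Rev₁ F = postedRev F := by
  have hmeas : Measurable fun (v : ℝ≥0) (_ : Fin 1) => v :=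
    measurable_pi_lambda _ fun _ => measurable_id
  refine le_antisymm (iSup₂_le fun m hm => tsub_le_self.trans ?_) (iSup_le fun p => ?_)
  · rw [lintegral_map m.measurable_s.ennreal_ofReal hmeas]
    exact lintegral_payment_le_postedRev hm.1 hm.2 F
  · refine le_trans (le_of_eq ?_) (le_iSup₂_of_le (posted p) ⟨isIC_posted p, isIR_posted p⟩ le_rfl)
    rw [revenue_eq_of_nonneg _ (posted_nonneg p),
      lintegral_map (posted p).measurable_s.ennreal_ofReal hmeas, lintegral_posted]

/-- Coordinates are optimised independently; this lets each item have its own near-optimal price in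
`SRev`. -/
theorem ENNReal.finsetSum_iSup_le_iSup {ι α : Type*} [Nonempty α] (s : Finset ι)
    (f : ι → α → ℝ≥0∞) : ∑ i ∈ s, ⨆ a, f i a ≤ ⨆ g : ι → α, ∑ i ∈ s, f i (g i) := by
  classical
  induction s using Finset.induction_on with
  | empty => simp
  | insert i s hi ih =>
    rw [Finset.sum_insert hi]
    refine (add_le_add_right ih _).trans (ENNReal.iSup_add_iSup_le fun a g => ?_)
    refine le_iSup_of_le (Function.update g i a) ?_
    rw [Finset.sum_insert hi, Function.update_self]
    gcongr with j hj
    rw [Function.update_of_ne fun h : j = i => hi (h ▸ hj)]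

theorem lintegral_separate {k : ℕ} (m : Fin k → Mechanism 1) (F : Fin k → Measure ℝ≥0)
    [∀ i, IsProbabilityMeasure (F i)] :
    ∫⁻ x, ∑ i, ENNReal.ofReal ((m i).s fun _ => x i) ∂Measure.pi F =
      ∑ i, ∫⁻ x, ENNReal.ofReal ((m i).s fun _ => x) ∂F i := by
  have hmeas : ∀ i, Measurable fun x : ℝ≥0 => ENNReal.ofReal ((m i).s fun _ => x) := fun i =>
    ((m i).measurable_s.comp (measurable_pi_lambda _ fun _ => measurable_id)).ennreal_ofReal
  rw [lintegral_finsetSum (f := fun i (x : Fin k → ℝ≥0) => ENNReal.ofReal ((m i).s fun _ => x i)) _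
    fun i _ => (hmeas i).comp (measurable_pi_apply i)]
  exact Finset.sum_congr rfl fun i _ =>
    (measurePreserving_eval F i).lintegral_comp (hmeas i)

theorem SRev_pi_eq_sum_postedRev {k : ℕ} (F : Fin k → Measure ℝ≥0)
    [∀ i, IsProbabilityMeasure (F i)] : SRev (Measure.pi F) = ∑ i, postedRev (F i) := by
  refine le_antisymm (iSup₂_le fun m hm => tsub_le_self.trans ?_)
    ((ENNReal.finsetSum_iSup_le_iSup _ _).trans (iSup_le fun p => ?_))
  · calc ∫⁻ x, ENNReal.ofReal ((separate m).s x) ∂Measure.pi F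
        ≤ ∫⁻ x, ∑ i, ENNReal.ofReal ((m i).s fun _ => x i) ∂Measure.pi F :=
          lintegral_mono fun x => Finset.le_sum_of_subadditive _ ENNReal.ofReal_zero.le
            (fun _ _ => ENNReal.ofReal_add_le) _ _
      _ = ∑ i, ∫⁻ x, ENNReal.ofReal ((m i).s fun _ => x) ∂F i := lintegral_separate m F
      _ ≤ ∑ i, postedRev (F i) :=
          Finset.sum_le_sum fun i _ => lintegral_payment_le_postedRev (hm i).1 (hm i).2 _
  · refine le_iSup₂_of_le (fun i => posted (p i))
      (fun i => ⟨isIC_posted _, isIR_posted _⟩) (le_of_eq ?_)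
    have h0 : ∀ x, 0 ≤ (separate fun i => posted (p i)).s x := fun x => by
      simp only [separate]
      exact Finset.sum_nonneg fun i _ => posted_nonneg _ _
    rw [revenue_eq_of_nonneg _ h0]
    simp_rw [← lintegral_posted]
    rw [← lintegral_separate]
    refine lintegral_congr fun x => ?_
    exact (ENNReal.ofReal_sum_of_nonneg fun i _ => posted_nonneg _ _).symm

theorem BRev_le {k : ℕ} (μ : Measure (Fin k → ℝ≥0)) [IsProbabilityMeasure μ] :
    BRev μ ≤ ⨆ p : ℝ≥0, (p : ℝ≥0∞) * μ {x | p ≤ ∑ i, x i} := by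
  have hsum : Measurable fun x : Fin k → ℝ≥0 => ∑ i, x i :=
    Finset.measurable_sum _ fun j _ => measurable_pi_apply j
  refine iSup₂_le fun m hm => tsub_le_self.trans ?_
  have hmeas : Measurable fun x : ℝ≥0 => ENNReal.ofReal (m.s fun _ => x) :=
    (m.measurable_s.comp (measurable_pi_lambda _ fun _ => measurable_id)).ennreal_ofReal
  have : IsProbabilityMeasure (μ.map fun x => ∑ i, x i) :=
    Measure.isProbabilityMeasure_map hsum.aemeasurable
  have h := lintegral_payment_le_postedRev hm.1 hm.2 (μ.map fun x => ∑ i, x i)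
  rw [lintegral_map hmeas hsum] at h
  refine h.trans (iSup_mono fun p => ?_)
  rw [Measure.map_apply hsum measurableSet_Ici]
  exact le_rfl

/-! ### Two items: tail of the sum -/

theorem measure_tail_le {F : Measure ℝ≥0} {a : ℝ} (h : postedRev F ≤ ENNReal.ofReal a) {t : ℝ}
    (ht : 0 < t) : F {x | t ≤ (x : ℝ)} ≤ ENNReal.ofReal (a / t) := by
  have h1 := (le_postedRev F t.toNNReal).trans h
  have h2 : Set.Ici t.toNNReal = {x : ℝ≥0 | t ≤ (x : ℝ)} := by
    ext x; simp [Real.toNNReal_le_iff_le_coe]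
  rw [h2] at h1
  rw [ENNReal.ofReal_div_of_pos ht, ENNReal.le_div_iff_mul_le (by simp [ht]) (by simp), mul_comm]
  exact h1

theorem lintegral_Ioc_ofReal_of_hasDerivAt {f f' : ℝ → ℝ} {u v : ℝ} (huv : u ≤ v)
    (hf : ∀ x ∈ Set.Icc u v, HasDerivAt f (f' x) x) (hc : ContinuousOn f' (Set.Icc u v))
    (h0 : ∀ x ∈ Set.Icc u v, 0 ≤ f' x) :
    ∫⁻ x in Set.Ioc u v, ENNReal.ofReal (f' x) = ENNReal.ofReal (f v - f u) := by
  have hint : IntervalIntegrable f' volume u v :=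
    ContinuousOn.intervalIntegrable (by rwa [Set.uIcc_of_le huv])
  rw [← intervalIntegral.integral_eq_sub_of_hasDerivAt (by rwa [Set.uIcc_of_le huv]) hint,
    intervalIntegral.integral_of_le huv, ofReal_integral_eq_lintegral_ofReal hint.1]
  exact (ae_restrict_iff' measurableSet_Ioc).2
    (Filter.Eventually.of_forall fun x hx => h0 x ⟨hx.1.le, hx.2⟩)

/-- Layer-cake bound: the tail is at most `1` up to level `u`, at most `g` between `u` and `v`, and
zero beyond. -/
theorem lintegral_ofReal_le_of_tail {F : Measure ℝ≥0} [IsProbabilityMeasure F] {f : ℝ≥0 → ℝ}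
    {h : ℝ → ℝ} {u v : ℝ} (hf : Measurable f) (hf0 : ∀ x, 0 ≤ f x)
    (hfv : ∀ x, f x ≤ v)
    (htail : ∀ t, u < t → t ≤ v → F {x | t ≤ f x} ≤ ENNReal.ofReal (h t)) :
    ∫⁻ x, ENNReal.ofReal (f x) ∂F ≤
      ENNReal.ofReal u + ∫⁻ t in Set.Ioc u v, ENNReal.ofReal (h t) := by
  rw [lintegral_eq_lintegral_meas_le F (Filter.Eventually.of_forall hf0) hf.aemeasurable]
  -- No order between `u` and `v` is assumed, so the region of zero tail starts at `max u v`.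
  have hsub : Set.Ioi (0 : ℝ) ⊆ Set.Ioc 0 u ∪ (Set.Ioc u v ∪ Set.Ioi (max u v)) := by
    intro t ht
    rcases le_or_gt t u with h1 | h1
    · exact Or.inl ⟨ht, h1⟩
    · rcases le_or_gt t v with h2 | h2
      · exact Or.inr (Or.inl ⟨h1, h2⟩)
      · exact Or.inr (Or.inr (max_lt h1 h2))
  refine (lintegral_mono_set hsub).trans ((lintegral_union_le _ _ _).trans ?_)
  refine add_le_add ?_ ((lintegral_union_le _ _ _).trans ?_)
  · refine (setLIntegral_mono' measurableSet_Ioc fun t _ => prob_le_one).trans ?_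
    simp
  · have h0 : ∫⁻ t in Set.Ioi (max u v), F {x | t ≤ f x} = 0 := by
      rw [setLIntegral_congr_fun (g := fun _ => 0) measurableSet_Ioi fun t ht => ?_, lintegral_zero]
      have : {x | t ≤ f x} = ∅ :=
        Set.eq_empty_of_forall_notMem fun x hx =>
          absurd (hfv x) (not_le.2 ((le_max_right u v).trans_lt (lt_of_lt_of_le ht hx)))
      simp [this]
    rw [h0, add_zero]
    exact setLIntegral_mono' measurableSet_Ioc fun t ht => htail t ht.1 ht.2

/-- Given the first value `x`, the second must be at least `p - x`, which has probability at most `b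
/ max (p - x) b`. The expectation of this decreasing-tail bound is then computed by layer cake from
the tail of `x`. -/
theorem prod_tail_le (F G : Measure ℝ≥0) [IsProbabilityMeasure F] [IsProbabilityMeasure G]
    {a b p : ℝ} (ha : 0 < a) (hb : 0 < b) (hp : a + b < p) (hF : postedRev F ≤ ENNReal.ofReal a)
    (hG : postedRev G ≤ ENNReal.ofReal b) :
    (F.prod G) {z | p ≤ (z.1 : ℝ) + z.2} ≤
      ENNReal.ofReal ((a + b + a * b / p * (Real.log ((p - a) / a) + Real.log ((p - b) / b))) / p) := by
  have hp0 : 0 < p := by linarith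
  have hpa : 0 < p - a := by linarith
  have hpb : 0 < p - b := by linarith
  have hms : MeasurableSet {z : ℝ≥0 × ℝ≥0 | p ≤ (z.1 : ℝ) + z.2} :=
    measurableSet_le measurable_const (by fun_prop)
  rw [Measure.prod_apply hms]
  have h1 : ∀ x : ℝ≥0, G (Prod.mk x ⁻¹' {z : ℝ≥0 × ℝ≥0 | p ≤ (z.1 : ℝ) + z.2}) ≤
      ENNReal.ofReal (b / max (p - x) b) := by
    intro x
    rcases le_total (p - x) b with h | h
    · rw [max_eq_right h, div_self hb.ne', ENNReal.ofReal_one]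
      exact prob_le_one
    · rw [max_eq_left h]
      refine le_trans (measure_mono fun y hy => ?_) (measure_tail_le hG (hb.trans_le h))
      simp only [Set.mem_preimage, Set.mem_ofPred_eq] at hy ⊢
      linarith
  refine (lintegral_mono h1).trans ?_
  -- At `t = u` the threshold `p - b / t` equals `a`, exactly where the tail bound `a / (p - b / t)`
  -- reaches 1.
  set u : ℝ := b / (p - a) with hu_def
  have hu : 0 < u := by positivity
  have hu1 : u ≤ 1 := (div_le_one hpa).2 (by linarith)
  have hub : p * u - b = a * b / (p - a) := by rw [hu_def]; field_simp; ring
  have hpos : ∀ t ∈ Set.Icc u 1, 0 < p * t - b := fun t ht => by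
    have : p * u ≤ p * t := by gcongr; exact ht.1
    have : 0 < a * b / (p - a) := by positivity
    linarith
  have htail : ∀ t, u < t → t ≤ 1 → F {x | t ≤ b / max (p - (x : ℝ)) b} ≤
      ENNReal.ofReal (a / p + a * b / p * (1 / (p * t - b))) := by
    intro t h1 h2
    have ht : 0 < t := hu.trans h1
    have h3 := hpos t ⟨h1.le, h2⟩
    have h4 : 0 < p - b / t := by
      have : p - b / t = (p * t - b) / t := by field_simp
      rw [this]; positivity
    -- Partial fractions, giving an elementary primitive.
    have h5 : a / p + a * b / p * (1 / (p * t - b)) = a / (p - b / t) := by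
      have : p - b / t = (p * t - b) / t := by field_simp
      rw [this]
      field_simp
      ring
    rw [h5]
    refine le_trans (measure_mono fun x hx => ?_) (measure_tail_le hF h4)
    simp only [Set.mem_ofPred_eq] at hx ⊢
    rw [le_div_iff₀ (hb.trans_le (le_max_right _ _))] at hx
    have : t * (p - x) ≤ b := le_trans (by gcongr; exact le_max_left _ _) hx
    have : p - x ≤ b / t := by rw [le_div_iff₀ ht]; linarith
    linarith
  refine (lintegral_ofReal_le_of_tail (by fun_prop) (fun x => by positivity)
    (fun x => (div_le_one (by positivity)).2 (le_max_right _ _)) htail).trans ?_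
  rw [lintegral_Ioc_ofReal_of_hasDerivAt
    (f := fun t => a / p * t + a * b / p ^ 2 * Real.log (p * t - b)) hu1]
  · rw [← ENNReal.ofReal_add hu.le]
    · refine ENNReal.ofReal_le_ofReal (le_of_eq ?_)
      rw [hub, Real.log_div hpa.ne' ha.ne', Real.log_div hpb.ne' hb.ne',
        Real.log_div (by positivity) hpa.ne', Real.log_mul ha.ne' hb.ne', mul_one, hu_def]
      field_simp
      ring
    · have : a / p * u ≤ a / p * 1 := by gcongr
      have h6 : Real.log (p * u - b) ≤ Real.log (p * 1 - b) := by
        refine Real.log_le_log (hpos u ⟨le_rfl, hu1⟩) ?_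
        gcongr
      have : a * b / p ^ 2 * Real.log (p * u - b) ≤ a * b / p ^ 2 * Real.log (p * 1 - b) := by
        gcongr
      linarith
  · intro t ht
    have h := hpos t ht
    have hd : HasDerivAt (fun t : ℝ => p * t - b) p t := by
      simpa using ((hasDerivAt_id t).const_mul p).sub_const b
    have h2 := ((hasDerivAt_id t).const_mul (a / p)).add
      ((hd.log h.ne').const_mul (a * b / p ^ 2))
    refine h2.congr_deriv ?_
    field_simp
  · refine ContinuousOn.add continuousOn_const (continuousOn_const.mul
      (continuousOn_const.div (by fun_prop) fun t ht => (hpos t ht).ne'))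
  · intro t ht
    have := hpos t ht
    positivity

/-! ### The constant `w` and the two-item bound -/

theorem pos_of_mul_exp_eq {w : ℝ} (hw : w * Real.exp w = 1 / Real.exp 1) : 0 < w := by
  by_contra! h
  have : 0 < 1 / Real.exp 1 := by positivity
  nlinarith [Real.exp_pos w]

/-- The equation for `w` says `log w = -1 - w`; substitute this in `log (w z) ≤ w z - 1`. -/
theorem log_le_of_mul_exp_eq {w : ℝ} (hw : w * Real.exp w = 1 / Real.exp 1) {z : ℝ} (hz : 0 < z) :
    Real.log z ≤ w * (1 + z) := by
  have hw0 := pos_of_mul_exp_eq hw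
  have h1 : Real.log w + w = -1 := by
    have := congrArg Real.log hw
    rwa [Real.log_mul hw0.ne' (Real.exp_pos _).ne', Real.log_exp, Real.log_div one_ne_zero
      (Real.exp_pos _).ne', Real.log_one, Real.log_exp, zero_sub] at this
  have h2 := Real.log_le_sub_one_of_pos (mul_pos hw0 hz)
  rw [Real.log_mul hw0.ne' hz.ne'] at h2
  linarith

theorem mul_prod_tail_le {w : ℝ} (hw : w * Real.exp w = 1 / Real.exp 1) 
    (F G : Measure ℝ≥0) [IsProbabilityMeasure F] [IsProbabilityMeasure G]
    {a b : ℝ} (ha : 0 < a) (hb : 0 < b) (hF : postedRev F ≤ ENNReal.ofReal a)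
    (hG : postedRev G ≤ ENNReal.ofReal b) (p : ℝ≥0) :
    (p : ℝ≥0∞) * (F.prod G) {z | (p : ℝ) ≤ (z.1 : ℝ) + z.2} ≤
      ENNReal.ofReal ((w + 1) * (a + b)) := by
  have hw0 := pos_of_mul_exp_eq hw
  rw [← ENNReal.ofReal_coe_nnreal]
  rcases le_or_gt (p : ℝ) (a + b) with h | h
  · refine (mul_le_of_le_one_right (zero_le) prob_le_one).trans (ENNReal.ofReal_le_ofReal ?_)
    nlinarith
  · refine (mul_le_mul_right (prod_tail_le F G ha hb h hF hG) _).trans ?_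
    rw [← ENNReal.ofReal_mul p.coe_nonneg]
    refine ENNReal.ofReal_le_ofReal ?_
    generalize (p : ℝ) = p at h
    have hp0 : 0 < p := by linarith
    rw [mul_div_cancel₀ _ hp0.ne']
    have h1 := log_le_of_mul_exp_eq hw (div_pos (by linarith : 0 < p - a) ha)
    have h2 := log_le_of_mul_exp_eq hw (div_pos (by linarith : 0 < p - b) hb)
    have h3 : a * b / p * (Real.log ((p - a) / a) + Real.log ((p - b) / b)) ≤
        a * b / p * (w * (1 + (p - a) / a) + w * (1 + (p - b) / b)) := by gcongr
    -- Here `1 + (p - a) / a = p / a` and likewise for `b`, so `p` cancels.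
    have h4 : a * b / p * (w * (1 + (p - a) / a) + w * (1 + (p - b) / b)) = w * (a + b) := by
      field_simp
      ring
    linarith

theorem mul_exp_lt_mul_exp {v w : ℝ} (hv : 0 < v) (h : v < w) :
    v * Real.exp v < w * Real.exp w :=
  mul_lt_mul h (Real.exp_le_exp.2 h.le) (Real.exp_pos _) (hv.trans h).le

/-- Every solution is positive, so strict monotonicity on the positive reals suffices for
uniqueness. -/
theorem existsUnique_mul_exp : ∃! w : ℝ, w * Real.exp w = 1 / Real.exp 1 := by
  have hmem : 1 / Real.exp 1 ∈ Set.Icc (0 * Real.exp 0) (1 * Real.exp 1) := by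
    have h1 : 1 ≤ Real.exp 1 := Real.one_le_exp zero_le_one
    have h2 : 1 / Real.exp 1 ≤ 1 := (div_le_one (Real.exp_pos 1)).2 h1
    refine ⟨by rw [zero_mul]; positivity, by linarith⟩
  obtain ⟨w, -, hw⟩ := intermediate_value_Icc (f := fun w : ℝ => w * Real.exp w) zero_le_one
    (by fun_prop) hmem
  refine ⟨w, hw, fun v hv => ?_⟩
  rcases lt_trichotomy v w with h | h | h
  · exact absurd (hv.trans hw.symm) (mul_exp_lt_mul_exp (pos_of_mul_exp_eq hv) h).ne
  · exact h
  · exact absurd (hw.trans hv.symm) (mul_exp_lt_mul_exp (pos_of_mul_exp_eq hw) h).ne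

theorem bounds_of_mul_exp {w : ℝ} (hw : w * Real.exp w = 1 / Real.exp 1) :
    1.278 ≤ w + 1 ∧ w + 1 < 1.279 := by
  have he := Real.exp_one_lt_d9
  have he' := Real.exp_one_gt_d9
  constructor
  · by_contra! h
    have h1 := mul_exp_lt_mul_exp (pos_of_mul_exp_eq hw) (by linarith : w < 0.278)
    have h2 := Real.exp_bound' (x := 0.278) (by norm_num) (by norm_num) (n := 5) (by norm_num)
    norm_num [Finset.sum_range_succ, Nat.factorial] at h2
    rw [hw, div_lt_iff₀ (Real.exp_pos _)] at h1
    norm_num at h1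
    nlinarith [Real.exp_pos (139 / 500)]
  · by_contra! h
    have h1 : 0.279 * Real.exp 0.279 ≤ w * Real.exp w := by
      rcases (by linarith : (0.279 : ℝ) ≤ w).eq_or_lt with h' | h'
      · rw [← h']
      · exact (mul_exp_lt_mul_exp (by norm_num) h').le
    have h2 := Real.sum_le_exp_of_nonneg (x := 0.279) (by norm_num) 5
    norm_num [Finset.sum_range_succ, Nat.factorial] at h2
    rw [hw, le_div_iff₀ (Real.exp_pos _)] at h1
    norm_num at h1
    nlinarith [Real.exp_pos (279 / 1000)]

/-! ### Many items: truncation and Chebyshev -/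

theorem measure_truncation_tail_le {F : Measure ℝ≥0} {a M : ℝ}
    (hF : postedRev F ≤ ENNReal.ofReal a) {t : ℝ} (ht : 0 < t) :
    F {x | t ≤ min (x : ℝ) M} ≤ ENNReal.ofReal (a / t) := by
  refine le_trans (measure_mono fun x hx => ?_) (measure_tail_le hF ht)
  rw [Set.mem_ofPred_eq] at hx ⊢
  exact hx.trans (min_le_left _ _)

/-- Layer cake with tail 1 below `c` and `a / t` above. The cutoff `c` is left free so that it can
be the same for all items. -/
theorem lintegral_truncation_le {F : Measure ℝ≥0} [IsProbabilityMeasure F] {a c M : ℝ}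
    (ha : 0 < a) (hc : 0 < c) (hcM : c ≤ M) (hF : postedRev F ≤ ENNReal.ofReal a) :
    ∫⁻ x, ENNReal.ofReal (min (x : ℝ) M) ∂F ≤ ENNReal.ofReal (c + a * Real.log (M / c)) := by
  have hM : 0 < M := hc.trans_le hcM
  refine (lintegral_ofReal_le_of_tail (h := fun t => a / t) (u := c) (v := M) (by fun_prop)
    (fun x => le_min x.coe_nonneg hM.le) (fun x => min_le_right _ _) fun t h1 h2 => ?_).trans ?_
  · exact measure_truncation_tail_le hF (hc.trans h1)
  · have hpos : ∀ t ∈ Set.Icc c M, 0 < t := fun t ht => hc.trans_le ht.1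
    rw [lintegral_Ioc_ofReal_of_hasDerivAt (f := fun t => a * Real.log t)
      (f' := fun t => a / t) hcM
      (fun t ht => by simpa [div_eq_mul_inv] using (Real.hasDerivAt_log (hpos t ht).ne').const_mul a)
      (continuousOn_const.div continuousOn_id fun t ht => (hpos t ht).ne')
      (fun t ht => by have := hpos t ht; positivity),
      ← mul_sub, ← Real.log_div hM.ne' hc.ne', ← ENNReal.ofReal_add hc.le]
    exact mul_nonneg ha.le (Real.log_nonneg ((one_le_div hc).2 hcM))

/-- In the layer cake for the square, the weight `2t` cancels the tail `a / t`, leaving the constant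
`2a` on `(0, M]`. -/
theorem lintegral_truncation_sq_le {F : Measure ℝ≥0} {a M : ℝ}
    (ha : 0 < a) (hM : 0 < M) (hF : postedRev F ≤ ENNReal.ofReal a) :
    ∫⁻ x, ENNReal.ofReal (min (x : ℝ) M ^ 2) ∂F ≤ ENNReal.ofReal (2 * a * M) := by
  have h := lintegral_comp_eq_lintegral_meas_le_mul (f := fun x : ℝ≥0 => min (x : ℝ) M)
    (g := fun t => 2 * t) F (Filter.Eventually.of_forall fun x => le_min x.coe_nonneg hM.le)
    (by fun_prop) (fun t _ => (by fun_prop : Continuous fun t : ℝ => 2 * t).intervalIntegrable _ _)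
    ((ae_restrict_iff' measurableSet_Ioi).2
      (Filter.Eventually.of_forall fun t ht => mul_nonneg zero_le_two (le_of_lt ht)))
  have h2 : ∀ y : ℝ, ∫ t in (0 : ℝ)..y, 2 * t = y ^ 2 := fun y => by
    rw [intervalIntegral.integral_const_mul, integral_id]; ring
  simp only [h2] at h
  rw [h]
  have h3 : ∀ t ∈ Set.Ioi (0 : ℝ), F {x | t ≤ min (x : ℝ) M} * ENNReal.ofReal (2 * t) ≤
      (Set.Ioc 0 M).indicator (fun _ => ENNReal.ofReal (2 * a)) t := by
    intro t ht
    have ht : 0 < t := ht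
    by_cases htM : t ≤ M
    · rw [Set.indicator_of_mem (show t ∈ Set.Ioc 0 M from ⟨ht, htM⟩)]
      refine (mul_le_mul_left (measure_truncation_tail_le hF ht) _).trans ?_
      rw [← ENNReal.ofReal_mul (by positivity)]
      refine ENNReal.ofReal_le_ofReal (le_of_eq ?_)
      field_simp
    · have : {x : ℝ≥0 | t ≤ min (x : ℝ) M} = ∅ :=
        Set.eq_empty_of_forall_notMem fun x hx => htM (le_min_iff.1 hx).2
      rw [this, measure_empty, zero_mul]
      exact zero_le
  refine (setLIntegral_mono' measurableSet_Ioi h3).trans ((setLIntegral_le_lintegral _ _).trans ?_)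
  rw [lintegral_indicator_const measurableSet_Ioc, Real.volume_Ioc, sub_zero,
    ← ENNReal.ofReal_mul (by positivity)]

theorem memLp_truncation (F : Measure ℝ≥0) [IsProbabilityMeasure F] {M : ℝ} (hM : 0 ≤ M)
    (q : ℝ≥0∞) : MemLp (fun x : ℝ≥0 => min (x : ℝ) M) q F := by
  refine MemLp.of_bound (by fun_prop : Measurable _).aestronglyMeasurable M
    (Filter.Eventually.of_forall fun x => ?_)
  rw [Real.norm_of_nonneg (le_min x.coe_nonneg hM)]
  exact min_le_right _ _

theorem integral_truncation_le {F : Measure ℝ≥0} [IsProbabilityMeasure F] {a c M : ℝ}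
    (ha : 0 < a) (hc : 0 < c) (hcM : c ≤ M) (hF : postedRev F ≤ ENNReal.ofReal a) :
    ∫ x, min (x : ℝ) M ∂F ≤ c + a * Real.log (M / c) := by
  have hM : 0 < M := hc.trans_le hcM
  have h0 : 0 ≤ c + a * Real.log (M / c) :=
    add_nonneg hc.le (mul_nonneg ha.le (Real.log_nonneg ((one_le_div hc).2 hcM)))
  rw [← ENNReal.ofReal_le_ofReal_iff h0, ofReal_integral_eq_lintegral_ofReal
    ((memLp_truncation F hM.le 1).integrable le_rfl)
    (Filter.Eventually.of_forall fun x => le_min x.coe_nonneg hM.le)]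
  exact lintegral_truncation_le ha hc hcM hF

theorem variance_truncation_le {F : Measure ℝ≥0} [IsProbabilityMeasure F] {a M : ℝ}
    (ha : 0 < a) (hM : 0 < M) (hF : postedRev F ≤ ENNReal.ofReal a) :
    ProbabilityTheory.variance (fun x : ℝ≥0 => min (x : ℝ) M) F ≤ 2 * a * M := by
  refine (ProbabilityTheory.variance_le_expectation_sq
    (memLp_truncation F hM.le 1).aestronglyMeasurable).trans ?_
  simp only [Pi.pow_apply]
  rw [← ENNReal.ofReal_le_ofReal_iff (by positivity), ofReal_integral_eq_lintegral_ofReal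
    (memLp_truncation F hM.le 2).integrable_sq
    (Filter.Eventually.of_forall fun x => sq_nonneg _)]
  exact lintegral_truncation_sq_le ha hM hF

/-- Chebyshev's inequality for the sum of the truncated values. -/
theorem pi_truncation_tail_le {k : ℕ} (F : Fin k → Measure ℝ≥0) [∀ i, IsProbabilityMeasure (F i)]
    {a : Fin k → ℝ} (ha : ∀ i, 0 < a i) (hF : ∀ i, postedRev (F i) ≤ ENNReal.ofReal (a i))
    {M : ℝ} (hM : 0 < M) (hmean : ∑ i, ∫ x, min (x : ℝ) M ∂F i ≤ M) :
    Measure.pi F {x | 2 * M ≤ ∑ i, min (x i : ℝ) M} ≤ ENNReal.ofReal (2 * (∑ i, a i) / M) := by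
  have hL : ∀ i, MemLp (fun x : Fin k → ℝ≥0 => min (x i : ℝ) M) 2 (Measure.pi F) := fun i =>
    (memLp_truncation (F i) hM.le 2).comp_measurePreserving (measurePreserving_eval F i)
  have hS : MemLp (∑ i, fun x : Fin k → ℝ≥0 => min (x i : ℝ) M) 2 (Measure.pi F) :=
    memLp_finsetSum' _ fun i _ => hL i
  have hE : ∫ x, (∑ i, fun x : Fin k → ℝ≥0 => min (x i : ℝ) M) x ∂Measure.pi F ≤ M := by
    simp only [Finset.sum_apply]
    rw [integral_finsetSum _ fun i _ => (hL i).integrable one_le_two]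
    refine le_trans (le_of_eq (Finset.sum_congr rfl fun i _ => ?_)) hmean
    exact integral_comp_eval (μ := F) (i := i) (f := fun x : ℝ≥0 => min (x : ℝ) M)
      (memLp_truncation (F i) hM.le 1).aestronglyMeasurable
  -- The mean is at most `M`, so reaching `2M` is a deviation of at least `M`; independence makes
  -- the variances add.
  have hC := ProbabilityTheory.meas_ge_le_variance_div_sq hS hM
  rw [ProbabilityTheory.variance_sum_pi fun i => memLp_truncation (F i) hM.le 2] at hC
  refine le_trans (measure_mono fun x hx => ?_) (hC.trans (ENNReal.ofReal_le_ofReal ?_))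
  · simp only [Set.mem_ofPred_eq, Finset.sum_apply] at hx hE ⊢
    exact le_trans (by linarith) (le_abs_self _)
  · have h := Finset.sum_le_sum fun i (_ : i ∈ Finset.univ) =>
      variance_truncation_le (ha i) hM (hF i)
    rw [← Finset.sum_mul, ← Finset.mul_sum] at h
    rw [div_le_div_iff₀ (by positivity) hM]
    nlinarith [mul_le_mul_of_nonneg_right h hM.le]

theorem pi_tail_le {k : ℕ} (F : Fin k → Measure ℝ≥0) [∀ i, IsProbabilityMeasure (F i)]
    {a : Fin k → ℝ} (ha : ∀ i, 0 < a i) (hF : ∀ i, postedRev (F i) ≤ ENNReal.ofReal (a i))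
    {M : ℝ} (hM : 0 < M) (hmean : ∑ i, ∫ x, min (x : ℝ) M ∂F i ≤ M) :
    Measure.pi F {x | 2 * M ≤ ∑ i, (x i : ℝ)} ≤ ENNReal.ofReal (3 * (∑ i, a i) / M) := by
  have hsub : {x : Fin k → ℝ≥0 | 2 * M ≤ ∑ i, (x i : ℝ)} ⊆
      (⋃ i, {x | M ≤ (x i : ℝ)}) ∪ {x | 2 * M ≤ ∑ i, min (x i : ℝ) M} := by
    intro x hx
    by_cases h : ∃ i, M ≤ (x i : ℝ)
    · exact Or.inl (Set.mem_iUnion.2 h)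
    · push Not at h
      refine Or.inr ?_
      simpa only [Set.mem_ofPred_eq, min_eq_left (h _).le] using hx
  have h1 : Measure.pi F (⋃ i, {x | M ≤ (x i : ℝ)}) ≤ ENNReal.ofReal ((∑ i, a i) / M) := by
    rw [Finset.sum_div, ENNReal.ofReal_sum_of_nonneg fun i _ => (div_pos (ha i) hM).le]
    refine (measure_iUnion_fintype_le _ _).trans (Finset.sum_le_sum fun i _ => ?_)
    refine le_trans (le_of_eq ?_) (measure_tail_le (hF i) hM)
    exact (measurePreserving_eval F i).measure_preimage
      (s := {x : ℝ≥0 | M ≤ (x : ℝ)})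
      (measurableSet_le measurable_const (by fun_prop)).nullMeasurableSet
  have h0 : 0 ≤ ∑ i, a i := Finset.sum_nonneg fun i _ => (ha i).le
  refine (measure_mono hsub).trans ((measure_union_le _ _).trans
    ((add_le_add h1 (pi_truncation_tail_le F ha hF hM hmean)).trans (le_of_eq ?_)))
  rw [← ENNReal.ofReal_add (by positivity) (by positivity)]
  congr 1
  ring

/-- The common cutoff `R / k` makes the low parts add up to `R`, while the logarithmic parts give `R
* log (M k / R)`. -/
theorem sum_integral_truncation_le {k : ℕ} (hk : 2 ≤ k) (F : Fin k → Measure ℝ≥0)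
    [∀ i, IsProbabilityMeasure (F i)] {a : Fin k → ℝ} (ha : ∀ i, 0 < a i)
    (hF : ∀ i, postedRev (F i) ≤ ENNReal.ofReal (a i)) {M : ℝ}
    (hM : 6 * Real.log k * ∑ i, a i ≤ M) :
    ∑ i, ∫ x, min (x : ℝ) M ∂F i ≤ M := by
  have hk0 : (0 : ℝ) < k := by positivity
  have hk2 : (2 : ℝ) ≤ k := by exact_mod_cast hk
  have hL2 : Real.log 2 ≤ Real.log k := Real.log_le_log two_pos hk2
  have hL := Real.log_two_gt_d9
  set R := ∑ i, a i
  have hne : (Finset.univ : Finset (Fin k)).Nonempty := ⟨⟨0, by lia⟩, Finset.mem_univ _⟩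
  have hR : 0 < R := Finset.sum_pos (fun i _ => ha i) hne
  have hRM : R ≤ M := by nlinarith
  have hMpos : 0 < M := hR.trans_le hRM
  have hc : 0 < R / k := by positivity
  have hcM : R / k ≤ M := (div_le_self hR.le (by linarith)).trans hRM
  refine (Finset.sum_le_sum fun i _ => integral_truncation_le (ha i) hc hcM (hF i)).trans ?_
  rw [Finset.sum_add_distrib, ← Finset.sum_mul, Finset.sum_const, Finset.card_univ,
    Fintype.card_fin, nsmul_eq_mul, mul_div_cancel₀ _ hk0.ne']
  change R + R * _ ≤ M
  -- Splitting off `M / (2R)` lets `log z ≤ z - 1` charge its logarithm to `M / 2`. The rest is at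
  -- most `2 R log k ≤ M / 3`.
  have e : M / (R / k) = 2 * (M / (2 * R)) * k := by field_simp
  rw [e, Real.log_mul (by positivity) hk0.ne', Real.log_mul two_ne_zero (by positivity)]
  have h3 := Real.log_le_sub_one_of_pos (div_pos hMpos (by positivity : 0 < 2 * R))
  have h4 : R * (1 + (Real.log 2 + Real.log (M / (2 * R)) + Real.log k)) ≤
      R * (M / (2 * R) + 2 * Real.log k) :=
    mul_le_mul_of_nonneg_left (by linarith) hR.le
  have h5 : R * (M / (2 * R) + 2 * Real.log k) = M / 2 + 2 * (R * Real.log k) := by field_simp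
  linarith

theorem mul_pi_tail_le {k : ℕ} (hk : 2 ≤ k) (F : Fin k → Measure ℝ≥0)
    [∀ i, IsProbabilityMeasure (F i)] {a : Fin k → ℝ} (ha : ∀ i, 0 < a i)
    (hF : ∀ i, postedRev (F i) ≤ ENNReal.ofReal (a i)) (p : ℝ≥0) :
    (p : ℝ≥0∞) * Measure.pi F {x | (p : ℝ) ≤ ∑ i, (x i : ℝ)} ≤
      ENNReal.ofReal (12 * Real.log k * ∑ i, a i) := by
  have hk2 : (2 : ℝ) ≤ k := by exact_mod_cast hk
  have hL2 : Real.log 2 ≤ Real.log k := Real.log_le_log two_pos hk2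
  have hL := Real.log_two_gt_d9
  have hR : 0 < ∑ i, a i := Finset.sum_pos (fun i _ => ha i) ⟨⟨0, by lia⟩, Finset.mem_univ _⟩
  rw [← ENNReal.ofReal_coe_nnreal]
  rcases le_or_gt (p : ℝ) (12 * Real.log k * ∑ i, a i) with h | h
  · exact (mul_le_of_le_one_right (zero_le) prob_le_one).trans (ENNReal.ofReal_le_ofReal h)
  · have hp : (0 : ℝ) < p := lt_trans (by nlinarith) h
    have hM : (0 : ℝ) < p / 2 := by positivity
    have h1 := pi_tail_le F ha hF hM (sum_integral_truncation_le hk F ha hF (by linarith))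
    rw [mul_div_cancel₀ _ two_ne_zero] at h1
    refine (mul_le_mul_right h1 _).trans ?_
    rw [← ENNReal.ofReal_mul p.coe_nonneg]
    refine ENNReal.ofReal_le_ofReal ?_
    have : (p : ℝ) * (3 * (∑ i, a i) / (p / 2)) = 6 * ∑ i, a i := by field_simp; ring
    rw [this]
    -- `6 ≤ 12 log k` because `log k ≥ log 2 > 1/2`.
    nlinarith

/-! ### Zero and infinite revenues, and conclusion -/

/-- The tail estimates divide by the bounds `a i`, so these must be positive reals. Taking `a i` to
be the revenue plus `ε` and letting `ε → 0` covers zero revenues; an infinite revenue makes the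
right side infinite. -/
theorem le_ofReal_mul_sum_of_forall_lt {ι : Type*} [Fintype ι] {r : ι → ℝ≥0∞} {B : ℝ≥0∞} {C : ℝ}
    (hC : 0 < C)
    (h : ∀ a : ι → ℝ, (∀ i, 0 < a i) → (∀ i, r i ≤ ENNReal.ofReal (a i)) →
      B ≤ ENNReal.ofReal (C * ∑ i, a i)) :
    B ≤ ENNReal.ofReal C * ∑ i, r i := by
  by_cases hr : ∃ i, r i = ⊤
  · rw [ENNReal.sum_eq_top.2 (by simpa using hr), ENNReal.mul_top (by simpa using hC)]
    exact le_top
  · push Not at hr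
    have hsum : ∑ i, r i = ENNReal.ofReal (∑ i, (r i).toReal) := by
      rw [ENNReal.ofReal_sum_of_nonneg fun i _ => ENNReal.toReal_nonneg]
      exact Finset.sum_congr rfl fun i _ => (ENNReal.ofReal_toReal (hr i)).symm
    rw [hsum, ← ENNReal.ofReal_mul hC.le]
    have hlim : Filter.Tendsto (fun ε : ℝ => ENNReal.ofReal (C * ∑ i, ((r i).toReal + ε)))
        (nhdsWithin 0 (Set.Ioi 0)) (nhds (ENNReal.ofReal (C * ∑ i, (r i).toReal))) := by
      have : Continuous fun ε : ℝ => ENNReal.ofReal (C * ∑ i, ((r i).toReal + ε)) :=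
        ENNReal.continuous_ofReal.comp (by fun_prop)
      simpa using (this.tendsto 0).mono_left nhdsWithin_le_nhds
    refine ge_of_tendsto hlim (eventually_nhdsWithin_of_forall fun ε hε => h _ (fun i => ?_)
      fun i => ?_)
    · exact add_pos_of_nonneg_of_pos ENNReal.toReal_nonneg hε
    · rw [← ENNReal.ofReal_toReal (hr i)]
      simp only [ENNReal.toReal_ofReal ENNReal.toReal_nonneg]
      exact ENNReal.ofReal_le_ofReal (le_add_of_nonneg_right (le_of_lt hε))

theorem SRev_pi {k : ℕ} (F : Fin k → Measure ℝ≥0) [∀ i, IsProbabilityMeasure (F i)] :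
    SRev (Measure.pi F) = ∑ i, Rev₁ (F i) := by
  simp_rw [SRev_pi_eq_sum_postedRev, Rev₁_eq_postedRev]

theorem BRev_pi_le {k : ℕ} (F : Fin k → Measure ℝ≥0) [∀ i, IsProbabilityMeasure (F i)] {C : ℝ}
    (hC : 0 < C)
    (h : ∀ a : Fin k → ℝ, (∀ i, 0 < a i) → (∀ i, postedRev (F i) ≤ ENNReal.ofReal (a i)) →
      ∀ p : ℝ≥0, (p : ℝ≥0∞) * Measure.pi F {x | (p : ℝ) ≤ ∑ i, (x i : ℝ)} ≤
        ENNReal.ofReal (C * ∑ i, a i)) :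
    BRev (Measure.pi F) ≤ ENNReal.ofReal C * ∑ i, Rev₁ (F i) := by
  simp_rw [Rev₁_eq_postedRev]
  refine le_ofReal_mul_sum_of_forall_lt hC fun a ha hF => (BRev_le _).trans (iSup_le fun p => ?_)
  have := h a ha hF p
  norm_cast at this

theorem BRev_pi_two_le {w : ℝ} (hw : w * Real.exp w = 1 / Real.exp 1) (F : Fin 2 → Measure ℝ≥0)
    [∀ i, IsProbabilityMeasure (F i)] :
    BRev (Measure.pi F) ≤ ENNReal.ofReal (w + 1) * ∑ i, Rev₁ (F i) := by
  refine BRev_pi_le F (by linarith [pos_of_mul_exp_eq hw]) fun a ha hF p => ?_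
  have h := mul_prod_tail_le hw (F 0) (F 1) (ha 0) (ha 1) (hF 0) (hF 1) p
  rw [← (measurePreserving_piFinTwo F).measure_preimage_equiv] at h
  simpa [Fin.sum_univ_two] using h

theorem BRev_pi_le_log {k : ℕ} (hk : 2 ≤ k) (F : Fin k → Measure ℝ≥0)
    [∀ i, IsProbabilityMeasure (F i)] :
    BRev (Measure.pi F) ≤ ENNReal.ofReal (12 * Real.log k) * ∑ i, Rev₁ (F i) :=
  BRev_pi_le F (mul_pos (by norm_num) (Real.log_pos (by exact_mod_cast hk)))
    fun _ ha hF p => mul_pi_tail_le hk F ha hF p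

theorem mainTheorem10 :
    (∃! w : ℝ, w * Real.exp w = 1 / Real.exp 1) ∧
    (∀ w : ℝ, w * Real.exp w = 1 / Real.exp 1 →
      (1.278 ≤ w + 1 ∧ w + 1 < 1.279) ∧
      ∀ F : Fin 2 → Measure ℝ≥0, (∀ i, IsProbabilityMeasure (F i)) →
        BRev (Measure.pi F) ≤ ENNReal.ofReal (w + 1) * (Rev₁ (F 0) + Rev₁ (F 1)) ∧
        ENNReal.ofReal (w + 1) * (Rev₁ (F 0) + Rev₁ (F 1)) =
          ENNReal.ofReal (w + 1) * SRev (Measure.pi F)) ∧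
    (∃ c : ℝ, 0 < c ∧ ∀ k : ℕ, 2 ≤ k →
      ∀ F : Fin k → Measure ℝ≥0, (∀ i, IsProbabilityMeasure (F i)) →
        BRev (Measure.pi F) ≤ ENNReal.ofReal (c * Real.log k) * ∑ i, Rev₁ (F i) ∧
        ENNReal.ofReal (c * Real.log k) * ∑ i, Rev₁ (F i) =
          ENNReal.ofReal (c * Real.log k) * SRev (Measure.pi F)) := by
  refine ⟨existsUnique_mul_exp, fun w hw => ⟨bounds_of_mul_exp hw, fun F hF => ?_⟩,
    12, by norm_num, fun k hk F hF => ?_⟩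
  · rw [SRev_pi, ← Fin.sum_univ_two fun i => Rev₁ (F i)]
    exact ⟨BRev_pi_two_le hw F, rfl⟩
  · rw [SRev_pi]
    exact ⟨BRev_pi_le_log hk F, rfl⟩
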